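/- **Setting.** Let $\mathcal V$ be a finite-dimensional real vector space with a positive semidefinite symmetric bilinear form $(\cdot,\cdot)$ and radical $\mathcal V^0$. For $R\subseteq\mathcal V$ put $R^0=R\cap\mathcal V^0$ and $R^\times=R\setminus R^0$. A set $\mathcal P$ of non-isotropic vectors is *connected* if it is not a disjoint union of two non-empty mutually orthogonal subsets. $R$ is an *extended affine root system* in $\mathcal V$ if: $0\in R$; $R=-R$; $R$ spans $\mathcal V$; $2\alpha\notin R$ for $\alpha\in R^\times$; $R$ is discrete; for $\alpha\in R^\times$, $\beta\in R$ there are integers $d,u\ge 0$ with $\{\beta+n\alpha\mid n\in\mathbb Z\}\cap R=\{\beta-d\alpha,\dots,\beta+u\alpha\}$ and $d-u=2(\alpha,\beta)/(\alpha,\alpha)$; $R^\times$ is connected; and for every $\sigma\in R^0$ there is $\alpha\in R^\times$ with $\alpha+\sigma\in R$. The image $\bar R$ of $R$ in $\mathcal V/\mathcal V^0$ is then an irreducible finite root system; the rank and type of $R$ are the rank and type (isomorphism class) of $\bar R$, the nullity of $R$ is $\dim\mathcal V^0$, and $R$ is *of reduced type* if $\bar R$ is reduced. Let $R$ be an extended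 affine root system of reduced type in $\mathcal V$. Choose a complement $\dot{\mathcal V}$ of $\mathcal V^0$ in $\mathcal V$ and extend the form to $\tilde{\mathcal V}=\dot{\mathcal V}\oplus\mathcal V^0\oplus(\mathcal V^0)^*$ by $(\sigma,\lambda)=\lambda(\sigma)$ for $\sigma\in\mathcal V^0$, $\lambda\in(\mathcal V^0)^*$, and $(\dot{\mathcal V},(\mathcal V^0)^*)=((\mathcal V^0)^*,(\mathcal V^0)^*)=\{0\}$. For $\alpha\in\mathcal V$ let $w_\alpha\in GL(\tilde{\mathcal V})$ be the reflection $\beta\mapsto\beta-\frac{2(\beta,\alpha)}{(\alpha,\alpha)}\alpha$ (the identity if $(\alpha,\alpha)=0$). For $\mathcal P\subseteq\mathcal V$ let $S_{\mathcal P}=\{w_\alpha\mid\alpha\in\mathcal P\}$ and $\mathcal W_{\mathcal P}=\langle S_{\mathcal P}\rangle$; the Weyl group of $R$ is $\mathcal W=\mathcal W_{R^\times}$. A set $\mathcal P\subseteq R^\times$ is *reflectable* if $\mathcal W_{\mathcal P}\mathcal P=R^\times$; it belongs to $\mathcal M_c$ if $S_{\mathcal P}$ generates $\mathcal W$ and $|\mathcal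 P|$ is the least number of reflections $w_\alpha$, $\alpha\in R^\times$, generating $\mathcal W$; it belongs to $\mathcal M_m$ if $S_{\mathcal P}$ generates $\mathcal W$ and no proper subset of $S_{\mathcal P}$ does. **Proposition.** Let $\emptyset\ne\mathcal P\subseteq R^\times$ be connected, and put $R^n_{\mathcal P}=\mathcal W_{\mathcal P}\mathcal P$, $R^i_{\mathcal P}=(R^n_{\mathcal P}-R^n_{\mathcal P})\cap R^0$ and $R_{\mathcal P}=R^n_{\mathcal P}\cup R^i_{\mathcal P}$. (i) With respect to the restricted form, $R_{\mathcal P}$ is an extended affine root system, again of reduced type, in $\mathcal V_{\mathcal P}=\mathrm{span}_{\mathbb R}R_{\mathcal P}$, with $R_{\mathcal P}^\times=R_{\mathcal P}^n$, $R_{\mathcal P}^0=R_{\mathcal P}^i$ and $\mathcal W_{\mathcal P}=\mathcal W_{R_{\mathcal P}}$. (ii) If $\mathcal W=\mathcal W_{\mathcal P}$, then $R_{\mathcal P}$ has the same rank, nullity and type as $R$. In particular this holds if $\mathcal P$ belongs to $\mathcal M_c$ or $\mathcal M_m$. (iii) If $\mathcal P$ is a reflectable set, then $R_{\mathcal P}=R$.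 -/

import Mathlib

open scoped Pointwise

namespace EARS

section Form

variable {U : Type*} [AddCommGroup U] [Module ℝ U]

/-- The radical `U⁰` of a (symmetric) bilinear form. -/
def radical (B : LinearMap.BilinForm ℝ U) : Submodule ℝ U := LinearMap.ker B

/-- `R⁰ = R ∩ U⁰`, the isotropic roots. -/
def isoRoots (B : LinearMap.BilinForm ℝ U) (R : Set U) : Set U := R ∩ (radical B : Set U)

/-- `R^× = R \ R⁰`, the non-isotropic roots. -/
def nonIsoRoots (B : LinearMap.BilinForm ℝ U) (R : Set U) : Set U := R \ isoRoots B R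

/-- A set is connected with respect to the form if it is not the disjoint union of two non-empty
subsets that are orthogonal to each other. -/
def Connected (B : LinearMap.BilinForm ℝ U) (P : Set U) : Prop :=
  ¬ ∃ P₁ P₂ : Set U, P₁ ∪ P₂ = P ∧ Disjoint P₁ P₂ ∧ P₁.Nonempty ∧ P₂.Nonempty ∧
    ∀ a ∈ P₁, ∀ b ∈ P₂, B a b = 0

/-- Extended affine root systems in the real vector space `U` with respect to the form `B`. -/
structure IsEARS [TopologicalSpace U] (B : LinearMap.BilinForm ℝ U) (R : Set U) : Prop where
  posSemidef : B.IsPosSemidef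
  zero_mem : (0 : U) ∈ R
  neg_eq : R = -R
  span_eq : Submodule.span ℝ R = ⊤
  two_nsmul_notMem : ∀ α ∈ nonIsoRoots B R, (2 : ℝ) • α ∉ R
  discrete : IsDiscrete R
  string : ∀ α ∈ nonIsoRoots B R, ∀ β ∈ R, ∃ d u : ℕ,
    (∀ n : ℤ, β + n • α ∈ R ↔ -(d : ℤ) ≤ n ∧ n ≤ (u : ℤ)) ∧
    (d : ℝ) - (u : ℝ) = 2 * B α β / B α α
  connected : Connected B (nonIsoRoots B R)
  exists_add_mem : ∀ σ ∈ isoRoots B R, ∃ α ∈ nonIsoRoots B R, α + σ ∈ R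

/-- `R̄`, the image of `R` in `Ū = U / U⁰`. -/
def quotRoots (B : LinearMap.BilinForm ℝ U) (R : Set U) : Set (U ⧸ radical B) :=
  (radical B).mkQ '' R

/-- `R` is of reduced type: the finite root system `R̄` is reduced. -/
def IsReducedType (B : LinearMap.BilinForm ℝ U) (R : Set U) : Prop :=
  ∀ a ∈ quotRoots B R, a ≠ 0 → (2 : ℝ) • a ∉ quotRoots B R

/-- The nullity of an extended affine root system in `U`: the dimension of `U⁰`. -/
noncomputable def nullity (B : LinearMap.BilinForm ℝ U) : ℕ := Module.finrank ℝ (radical B)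

/-- The rank of an extended affine root system in `U`, which is the rank of the finite root
system `R̄` in `Ū`, that is the dimension of `Ū`. -/
noncomputable def rank (B : LinearMap.BilinForm ℝ U) : ℕ := Module.finrank ℝ (U ⧸ radical B)

/-- Two extended affine root systems have the same type if their finite quotient root systems
`R̄` and `R̄'` are isomorphic: some linear isomorphism `Ū ≃ Ū'` maps `R̄` onto `R̄'`. -/
def SameType {U' : Type*} [AddCommGroup U'] [Module ℝ U'] (B : LinearMap.BilinForm ℝ U)
    (R : Set U) (B' : LinearMap.BilinForm ℝ U') (R' : Set U') : Prop :=
  ∃ φ : (U ⧸ radical B) ≃ₗ[ℝ] (U' ⧸ radical B'), φ '' quotRoots B R = quotRoots B' R'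

/-- The reflection `w_α : β ↦ β - (2 (β, α) / (α, α)) α`. If `(α, α) = 0`, the quotient is `0` in
Lean and `w_α` is the identity, as it should be by convention. -/
noncomputable def reflection (B : LinearMap.BilinForm ℝ U) (α : U) : U ≃ₗ[ℝ] U :=
  LinearEquiv.ofInvolutive
    { toFun := fun β => β - (2 * B β α / B α α) • α
      map_add' := fun x y => by
        simp only [map_add, LinearMap.add_apply, mul_add, add_div, add_smul]; abel
      map_smul' := fun c x => by
        simp only [map_smul, LinearMap.smul_apply, smul_eq_mul, RingHom.id_apply, smul_sub,
          smul_smul]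
        congr 2; ring }
    (fun x => by
      by_cases h : B α α = 0
      · simp [h]
      · have h2 : 2 * B α α / B α α = 2 := by field_simp
        simp only [LinearMap.coe_mk, AddHom.coe_mk, map_sub, map_smul, h2]
        module)

end Form

section Weyl

variable {V : Type*} [AddCommGroup V] [Module ℝ V]

/-- The space `Ṽ = V ⊕ (V⁰)^*` (where `V = D ⊕ V⁰` for a complement `D` of the radical). -/
abbrev Hyp (B : LinearMap.BilinForm ℝ V) : Type _ := V × Module.Dual ℝ (radical B)

/-- The form on `Ṽ = D ⊕ V⁰ ⊕ (V⁰)^*`: it extends the form of `V`, it vanishes on `D × (V⁰)^*` and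
on `(V⁰)^* × (V⁰)^*`, and `(σ, l) = l σ` for `σ ∈ V⁰`, `l ∈ (V⁰)^*`. -/
noncomputable def hypForm (B : LinearMap.BilinForm ℝ V) {D : Submodule ℝ V}
    (hD : IsCompl (radical B) D) : LinearMap.BilinForm ℝ (Hyp B) :=
  LinearMap.mk₂ ℝ
    (fun x y => B x.1 y.1 + x.2 ((radical B).projectionOnto D hD y.1)
      + y.2 ((radical B).projectionOnto D hD x.1))
    (fun x x' y => by simp; ring) (fun c x y => by simp; ring)
    (fun x y y' => by simp; ring) (fun c x y => by simp; ring)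

variable (B : LinearMap.BilinForm ℝ V) {D : Submodule ℝ V} (hD : IsCompl (radical B) D)

/-- `S_P`, the set of the reflections `w_α` of `Ṽ` with `α ∈ P`. -/
def reflSet (P : Set V) : Set (Hyp B ≃ₗ[ℝ] Hyp B) :=
  {w | ∃ α ∈ P, w = reflection (hypForm B hD) (α, 0)}

/-- `W_P`, the subgroup of `GL(Ṽ)` generated by the reflections `w_α`, `α ∈ P`. -/
def weyl (P : Set V) : Subgroup (Hyp B ≃ₗ[ℝ] Hyp B) := Subgroup.closure (reflSet B hD P)

/-- `W_P P`, as a subset of `V ⊆ Ṽ`; this is the set `R_P^n`. -/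
def orbit (P : Set V) : Set V :=
  {β | ∃ w ∈ weyl B hD P, ∃ α ∈ P, w (α, 0) = (β, 0)}

/-- `R_P^i = (R_P^n - R_P^n) ∩ R⁰`. -/
def subIso (R P : Set V) : Set V := (orbit B hD P - orbit B hD P) ∩ isoRoots B R

/-- `R_P = R_P^n ∪ R_P^i`. -/
def subsystem (R P : Set V) : Set V := orbit B hD P ∪ subIso B hD R P

/-- The Weyl group `W` of `R`. -/
def weylGroup (R : Set V) : Subgroup (Hyp B ≃ₗ[ℝ] Hyp B) := weyl B hD (nonIsoRoots B R)

/-- Reflectable sets. -/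
def IsReflectable (R P : Set V) : Prop := P ⊆ nonIsoRoots B R ∧ orbit B hD P = nonIsoRoots B R

/-- `c`, the least number of reflections generating `W` (`⊤` if `W` is not generated by finitely
many reflections). -/
noncomputable def minRefl (R : Set V) : ℕ∞ :=
  sInf {n | ∃ T ⊆ reflSet B hD (nonIsoRoots B R), Subgroup.closure T = weylGroup B hD R ∧ n = T.encard}

/-- The class `M_c` of `c`-minimal sets. -/
def IsCMinimal (R P : Set V) : Prop :=
  P ⊆ nonIsoRoots B R ∧ P.encard = minRefl B hD R ∧
    Subgroup.closure (reflSet B hD P) = weylGroup B hD R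

/-- The class `M_m` of `S`-minimal sets. -/
def IsSMinimal (R P : Set V) : Prop :=
  P ⊆ nonIsoRoots B R ∧ Subgroup.closure (reflSet B hD P) = weylGroup B hD R ∧
    ∀ T, T ⊂ reflSet B hD P → Subgroup.closure T ≠ weylGroup B hD R

/-- `V_P = span R_P`. -/
def subSpan (R P : Set V) : Submodule ℝ V := Submodule.span ℝ (subsystem B hD R P)

/-- The restriction of the form to `V_P`. -/
def subForm (R P : Set V) : LinearMap.BilinForm ℝ (subSpan B hD R P) :=
  B.restrict (subSpan B hD R P)

/-- `R_P`, as a subset of `V_P`. -/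
def subIn (R P : Set V) : Set (subSpan B hD R P) := Subtype.val ⁻¹' subsystem B hD R P

end Weyl

end EARS

/-! That `R_P` is again an extended affine root system rests on one fact: if `(α, β) < 0` with `α`
in the orbit and `β` in `R_P`, then `α + β` lies in `R_P`. By Cauchy–Schwarz the two Cartan integers
are negative with product at most 4. So either one is -1, and a reflection produces the sum, or both
are -2, and the sum is isotropic, hence a difference of orbit elements (`reflection_eq_add_or`,
`add_mem_subsystem`). With the symmetry under `w_α`, this makes root strings unbroken
(`exists_string`).

When `W = W_P`, the span is recovered because elements of `W_P` displace vectors of `V` by elements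
of `span P`. For the type, suppose `w_α ∈ W_P` but no root of `R_P` agrees with `α` modulo the
radical. Take a generic `x` orthogonal to `α` and let `Q` be the product of the roots of `R̄_P`
positive at `x`. Then `Q (w x) = det w * Q x` on `W_P`, yet `w_α` fixes `x` and has determinant -1,
a contradiction (`exists_mem_orbit_apply_eq`). -/

namespace EARS

/-! ### Reflections and semidefinite forms -/

section Form

variable {U : Type*} [AddCommGroup U] [Module ℝ U] {B : LinearMap.BilinForm ℝ U}

lemma reflection_apply (B : LinearMap.BilinForm ℝ U) (α x : U) :
    reflection B α x = x - (2 * B x α / B α α) • α := rfl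

lemma reflection_reflection (B : LinearMap.BilinForm ℝ U) (α x : U) :
    reflection B α (reflection B α x) = x := (reflection B α).symm_apply_apply x

lemma reflection_self {α : U} (h : B α α ≠ 0) : reflection B α α = -α := by
  rw [reflection_apply, mul_div_assoc, div_self h]
  module

lemma reflection_of_apply_eq_zero {α x : U} (h : B x α = 0) : reflection B α x = x := by
  simp [reflection_apply, h]

lemma reflection_of_isotropic {α : U} (h : B α α = 0) : reflection B α = 1 := by
  ext x
  simp [reflection_apply, h]

lemma apply_reflection_reflection (hB : B.IsSymm) (α x y : U) :
    B (reflection B α x) (reflection B α y) = B x y := by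
  by_cases h : B α α = 0
  · simp [reflection_of_isotropic h]
  · simp only [reflection_apply, map_sub, map_smul, LinearMap.sub_apply, LinearMap.smul_apply,
      smul_eq_mul, hB.eq α y]
    field_simp
    ring

lemma apply_reflection (hB : B.IsSymm) (α x y : U) :
    B x (reflection B α y) = B (reflection B α x) y := by
  rw [← apply_reflection_reflection hB α x, reflection_reflection]

lemma apply_comp_reflection (hB : B.IsSymm) (α β : U) :
    B β ∘ₗ (reflection B α : U →ₗ[ℝ] U) = B (reflection B α β) :=
  LinearMap.ext fun y => apply_reflection hB α β y

lemma reflection_map (w : U ≃ₗ[ℝ] U) (hw : ∀ x y, B (w x) (w y) = B x y) (α : U) :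
    reflection B (w α) = w * reflection B α * w⁻¹ := by
  ext x
  obtain ⟨y, rfl⟩ := w.surjective x
  have : w⁻¹ (w y) = y := w.symm_apply_apply y
  simp [reflection_apply, LinearEquiv.mul_apply, this, hw]

/-- A reflection has the shape `x ↦ x + f x • α` with `f α = -2`, and such a map has determinant `1
+ f α`. -/
lemma det_reflection [FiniteDimensional ℝ U] {α : U} (h : B α α ≠ 0) :
    LinearMap.det (reflection B α : U →ₗ[ℝ] U) = -1 := by
  have : (reflection B α : U →ₗ[ℝ] U) =
      LinearMap.transvection ((-(2 / B α α)) • B.flip α) α := by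
    ext x
    have : B.flip α x = B x α := rfl
    simp only [LinearEquiv.coe_coe, reflection_apply, LinearMap.transvection.apply,
      LinearMap.smul_apply, smul_eq_mul, this]
    module
  have h' : B.flip α α = B α α := rfl
  rw [this, LinearMap.transvection.det, LinearMap.smul_apply, h', smul_eq_mul, neg_mul,
    div_mul_cancel₀ _ h]
  norm_num

/-- Cauchy–Schwarz. This reduces isotropy to a condition on `x` alone, so it passes to subspaces. -/
lemma mem_radical_iff (hB : B.IsPosSemidef) {x : U} : x ∈ radical B ↔ B x x = 0 := by
  refine ⟨fun h => by rw [show B x = 0 from h]; rfl, fun h => ?_⟩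
  refine LinearMap.mem_ker.2 (LinearMap.ext fun y => ?_)
  have := B.apply_sq_le_of_symm hB.nonneg (LinearMap.BilinForm.isSymm_iff.1 hB.isSymm) x y
  rw [h, zero_mul] at this
  simpa using pow_eq_zero_iff two_ne_zero |>.1 (le_antisymm this (sq_nonneg _))

lemma mem_nonIsoRoots_iff (hB : B.IsPosSemidef) {R : Set U} {x : U} :
    x ∈ nonIsoRoots B R ↔ x ∈ R ∧ B x x ≠ 0 := by
  simp only [nonIsoRoots, isoRoots, Set.mem_sdiff, Set.mem_inter_iff, SetLike.mem_coe,
    mem_radical_iff hB]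
  tauto

lemma apply_self_pos (hB : B.IsPosSemidef) {x : U} (h : B x x ≠ 0) : 0 < B x x :=
  lt_of_le_of_ne (hB.nonneg x) (Ne.symm h)

lemma sq_apply_le (hB : B.IsPosSemidef) (x y : U) : B x y ^ 2 ≤ B x x * B y y :=
  B.apply_sq_le_of_symm hB.nonneg (LinearMap.BilinForm.isSymm_iff.1 hB.isSymm) x y

/-! ### Cartan integers of an extended affine root system -/

namespace IsEARS

variable [TopologicalSpace U] {R : Set U}

lemma neg_mem (hR : IsEARS B R) {x : U} (hx : x ∈ R) : -x ∈ R := by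
  rw [hR.neg_eq]; simpa using hx

lemma exists_int (hR : IsEARS B R) {α β : U} (hα : α ∈ nonIsoRoots B R) (hβ : β ∈ R) :
    ∃ c : ℤ, (c : ℝ) = 2 * B α β / B α α := by
  obtain ⟨d, u, -, h⟩ := hR.string α hα β hβ
  exact ⟨d - u, by push_cast; exact h⟩

lemma reflection_mem (hR : IsEARS B R) {α β : U} (hα : α ∈ nonIsoRoots B R) (hβ : β ∈ R) :
    reflection B α β ∈ R := by
  obtain ⟨d, u, h, hdu⟩ := hR.string α hα β hβ
  -- `w_α β = β - (d - u) α`, and `u - d` always lies between `-d` and `u`.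
  have := (h (u - d)).2 ⟨by omega, by omega⟩
  convert this using 1
  rw [reflection_apply, ← hR.posSemidef.isSymm.eq α β, ← hdu, sub_eq_add_neg, ← neg_smul,
    ← Int.cast_smul_eq_zsmul ℝ]
  push_cast
  simp

lemma reflection_mem_nonIsoRoots (hR : IsEARS B R) {α β : U} (hα : α ∈ nonIsoRoots B R)
    (hβ : β ∈ nonIsoRoots B R) : reflection B α β ∈ nonIsoRoots B R := by
  have hs := hR.posSemidef
  rw [mem_nonIsoRoots_iff hs] at hβ ⊢
  exact ⟨hR.reflection_mem hα hβ.1,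
    by rw [apply_reflection_reflection hs.isSymm]; exact hβ.2⟩

/-- An isotropic root `σ` is the difference of the non-isotropic roots `α + σ` and `α`. -/
lemma span_nonIsoRoots (hR : IsEARS B R) : Submodule.span ℝ (nonIsoRoots B R) = ⊤ := by
  rw [eq_top_iff, ← hR.span_eq, Submodule.span_le]
  intro x hx
  by_cases h : x ∈ radical B
  · obtain ⟨α, hα, hαx⟩ := hR.exists_add_mem x ⟨hx, h⟩
    have : α + x ∈ nonIsoRoots B R :=
      ⟨hαx, fun h' => hα.2 ⟨hα.1, by simpa using sub_mem h'.2 h⟩⟩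
    have h2 := sub_mem (Submodule.subset_span (R := ℝ) this) (Submodule.subset_span hα)
    simpa using h2
  · exact Submodule.subset_span ⟨hx, fun h' => h h'.2⟩

/-- Two roots at an obtuse angle: a reflection takes one of them to their sum, or the sum is
isotropic. -/
lemma reflection_eq_add_or (hR : IsEARS B R) {α β : U} (hα : α ∈ nonIsoRoots B R)
    (hβ : β ∈ nonIsoRoots B R) (h : B α β < 0) :
    reflection B α β = β + α ∨ reflection B β α = β + α ∨ β + α ∈ isoRoots B R := by
  have hs := hR.posSemidef
  obtain ⟨hαR, hα0⟩ := (mem_nonIsoRoots_iff hs).1 hα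
  obtain ⟨hβR, hβ0⟩ := (mem_nonIsoRoots_iff hs).1 hβ
  have ha := apply_self_pos hs hα0
  have hb := apply_self_pos hs hβ0
  obtain ⟨m, hm⟩ := hR.exists_int hα hβR
  obtain ⟨n, hn⟩ := hR.exists_int hβ hαR
  have hsym : B β α = B α β := hs.isSymm.eq α β |>.symm
  rw [hsym] at hn
  have hcs := sq_apply_le hs α β
  have hm0 : m < 0 := by
    have : (m : ℝ) < 0 := by rw [hm]; exact div_neg_of_neg_of_pos (by linarith) ha
    exact_mod_cast this
  have hn0 : n < 0 := by
    have : (n : ℝ) < 0 := by rw [hn]; exact div_neg_of_neg_of_pos (by linarith) hb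
    exact_mod_cast this
  have hmn : m * n ≤ 4 := by
    have : (m * n : ℝ) ≤ 4 := by
      rw [hm, hn, div_mul_div_comm, div_le_iff₀ (by positivity)]
      linarith
    exact_mod_cast this
  by_cases h1 : m = -1
  · left
    rw [reflection_apply, hsym, ← hm, h1]; push_cast; module
  by_cases h2 : n = -1
  · right; left
    rw [reflection_apply, ← hn, h2]; push_cast; module
  -- Both integers are now at most -2 with product at most 4: the equality case of Cauchy–Schwarz.
  have hm2 : m = -2 := by nlinarith [show m ≤ -2 by omega, show n ≤ -2 by omega]
  have hn2 : n = -2 := by nlinarith [show m ≤ -2 by omega, show n ≤ -2 by omega]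
  right; right
  have e1 : B α β = -B α α := by
    rw [hm2, eq_div_iff ha.ne'] at hm; push_cast at hm; linarith
  have e2 : B α β = -B β β := by
    rw [hn2, eq_div_iff hb.ne'] at hn; push_cast at hn; linarith
  constructor
  · obtain ⟨d, u, hdu, hc⟩ := hR.string α hα β hβR
    rw [← hm, hm2] at hc
    have hc' : (d : ℤ) - u = -2 := by exact_mod_cast hc
    simpa using (hdu 1).2 ⟨by omega, by omega⟩
  · rw [SetLike.mem_coe, mem_radical_iff hs]
    simp only [map_add, LinearMap.add_apply, hsym]
    linarith

/-- In the reduced case, proportional elements of `R̄` agree up to sign. -/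
lemma eq_or_eq_neg_of_apply_eq_smul (hR : IsEARS B R) (hred : IsReducedType B R) {α β : U}
    (hα : α ∈ nonIsoRoots B R) (hβ : β ∈ nonIsoRoots B R) {c : ℝ} (h : B β = c • B α) :
    B β = B α ∨ B β = -B α := by
  have hs := hR.posSemidef
  obtain ⟨hαR, hα0⟩ := (mem_nonIsoRoots_iff hs).1 hα
  obtain ⟨hβR, hβ0⟩ := (mem_nonIsoRoots_iff hs).1 hβ
  obtain ⟨m, hm⟩ := hR.exists_int hα hβR
  obtain ⟨n, hn⟩ := hR.exists_int hβ hαR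
  have hsym : B β α = B α β := hs.isSymm.eq α β |>.symm
  have h1 : B α β = c * B α α := by rw [← hsym, h]; simp
  have h2 : B β β = c * (c * B α α) := by rw [h]; simp [h1]
  have hc : c ≠ 0 := by rintro rfl; simp [h2] at hβ0
  have hm' : (m : ℝ) = 2 * c := by rw [hm, h1]; field_simp
  have hn' : (n : ℝ) * c = 2 := by rw [hn, hsym, h2, h1]; field_simp
  have hmn : m * n = 4 := by
    have : (m * n : ℝ) = 4 := by rw [hm']; linarith
    exact_mod_cast this
  -- Reducedness of `R̄`, read on functionals: `B` identifies `U / U⁰` with its image in the dual.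
  have key : ∀ {a b : U}, a ∈ nonIsoRoots B R → b ∈ R → B b ≠ (2 : ℝ) • B a := by
    intro a b ha hb hab
    refine hred _ ⟨a, ha.1, rfl⟩ (fun h0 => ha.2 ⟨ha.1, ?_⟩) ⟨b, hb, ?_⟩
    · simpa using h0
    · rw [← map_smul, Submodule.mkQ_apply, Submodule.mkQ_apply, Submodule.Quotient.eq]
      exact LinearMap.mem_ker.2 (by simp [hab])
  have hdvd : m ∣ 4 := ⟨n, hmn.symm⟩
  have hb1 : m ≤ 4 := Int.le_of_dvd (by norm_num) hdvd
  have hb2 : -m ≤ 4 := Int.le_of_dvd (by norm_num) (by simpa using hdvd)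
  have hm1 : -4 ≤ m := by omega
  have hnb : B (-β) = -B β := by simp
  -- Since `m = 2c` divides 4, `c` is ±1, ±2 or ±1/2; reducedness excludes the last two pairs.
  interval_cases m
  · exact absurd (by rw [hnb, h, show c = -2 by push_cast at hm'; linarith]; module)
      (key hα (hR.neg_mem hβR))
  · omega
  · right; rw [h, show c = -1 by push_cast at hm'; linarith]; module
  · refine absurd ?_ (key hβ (hR.neg_mem hαR))
    rw [h, show c = -1/2 by push_cast at hm'; linarith, map_neg]; module
  · omega
  · refine absurd ?_ (key hβ hαR)
    rw [h, show c = 1/2 by push_cast at hm'; linarith]; module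
  · left; rw [h, show c = 1 by push_cast at hm'; linarith]; module
  · omega
  · exact absurd (by rw [h, show c = 2 by push_cast at hm'; linarith])
      (key hα hβR)

/-- The quotient root system `R̄`, realised by the functionals `(α, ·)`, is finite. -/
lemma finite_image (hR : IsEARS B R) [FiniteDimensional ℝ U] :
    (B '' nonIsoRoots B R).Finite := by
  have hs := hR.posSemidef
  obtain ⟨b, hbR, hbs, hbi⟩ := exists_linearIndependent ℝ (nonIsoRoots B R)
  have hbf : Finite b := hbi.finite
  have hspan : Submodule.span ℝ b = ⊤ := by rw [hbs, hR.span_nonIsoRoots]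
  -- A functional is determined by its Cartan numbers against a basis of roots; on roots these are
  -- integers in `[-4, 4]`.
  let F : Module.Dual ℝ U → b → ℝ := fun f a => 2 * f a / B a a
  have hFinj : Function.Injective F := by
    intro f g hfg
    refine LinearMap.ext_on hspan fun a ha => ?_
    have h1 := congrFun hfg ⟨a, ha⟩
    have := ((mem_nonIsoRoots_iff hs).1 (hbR ha)).2
    simp only [F] at h1
    field_simp at h1
    exact h1
  refine Set.Finite.of_finite_image (f := F) ?_ hFinj.injOn
  refine (Set.Finite.pi' (t := fun _ : b => (fun n : ℤ => (n : ℝ)) '' Set.Icc (-4) 4)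
    (fun _ => (Set.finite_Icc _ _).image _)).subset ?_
  rintro _ ⟨_, ⟨β, hβ, rfl⟩, rfl⟩ ⟨α, hα⟩
  replace hα := hbR hα
  obtain ⟨hαR, hα0⟩ := (mem_nonIsoRoots_iff hs).1 hα
  obtain ⟨hβR, hβ0⟩ := (mem_nonIsoRoots_iff hs).1 hβ
  have ha := apply_self_pos hs hα0
  have hb := apply_self_pos hs hβ0
  obtain ⟨m, hm⟩ := hR.exists_int hα hβR
  obtain ⟨n, hn⟩ := hR.exists_int hβ hαR
  have hsym : B β α = B α β := hs.isSymm.eq α β |>.symm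
  refine ⟨m, ?_, by simp only [F, hm, hsym]⟩
  rw [hsym] at hn
  have hcs := sq_apply_le hs α β
  have hmn : m * n ≤ 4 := by
    have : (m * n : ℝ) ≤ 4 := by
      rw [hm, hn, div_mul_div_comm, div_le_iff₀ (by positivity)]
      linarith
    exact_mod_cast this
  have hmn0 : 0 ≤ m * n := by
    have : (0 : ℝ) ≤ m * n := by
      rw [hm, hn, div_mul_div_comm]
      exact div_nonneg (by nlinarith [sq_nonneg (B α β)]) (by positivity)
    exact_mod_cast this
  by_cases hn0 : n = 0
  · have : B α β = 0 := by
      rw [hn0, eq_div_iff hb.ne'] at hn; push_cast at hn; linarith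
    have : m = 0 := by
      have : (m : ℝ) = 0 := by rw [hm, this]; simp
      exact_mod_cast this
    simp [this]
  · have h1 : |m| ≤ |m * n| := by
      rw [abs_mul]; exact le_mul_of_one_le_right (abs_nonneg _) (Int.one_le_abs hn0)
    rw [abs_of_nonneg hmn0] at h1
    exact ⟨by linarith [neg_abs_le m], by linarith [le_abs_self m]⟩

end IsEARS

end Form

/-- A bounded set of integers that contains `0`, is symmetric about `-c / 2`, and has no right
end point to the left of `-c / 2` is an interval. -/
lemma exists_string {S : Set ℤ} {c : ℤ} (h0 : 0 ∈ S) (hbdd : BddAbove S)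
    (hsymm : ∀ n ∈ S, -c - n ∈ S) (hstep : ∀ n ∈ S, 2 * n + c < 0 → n + 1 ∈ S) :
    ∃ d u : ℕ, (∀ n : ℤ, n ∈ S ↔ -(d : ℤ) ≤ n ∧ n ≤ (u : ℤ)) ∧ (d : ℤ) - u = c := by
  obtain ⟨u, huS, hu⟩ : ∃ u ∈ S, ∀ n ∈ S, n ≤ u := by
    obtain ⟨b, hb⟩ := hbdd
    obtain ⟨u, hu, hu'⟩ := Int.exists_greatest_of_bdd (P := (· ∈ S)) ⟨b, fun z hz => hb hz⟩ ⟨0, h0⟩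
    exact ⟨u, hu, hu'⟩
  have hstep' : ∀ n ∈ S, 0 < 2 * n + c → n - 1 ∈ S := fun n hn h => by
    have := hsymm _ (hstep _ (hsymm n hn) (by omega))
    convert this using 1; omega
  -- Descend from the maximum `u` to the centre `-c / 2`; the rest of the interval follows by
  -- symmetry.
  have half : ∀ k : ℕ, 2 * (k : ℤ) ≤ 2 * u + c + 1 → u - k ∈ S := by
    intro k
    induction k with
    | zero => intro _; simpa using huS
    | succ k ih =>
      intro hk
      push_cast at hk
      have := hstep' _ (ih (by omega)) (by omega)
      convert this using 1; push_cast; ring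
  have hu0 := hu 0 h0
  have hc0 := hu _ (hsymm 0 h0)
  refine ⟨(u + c).toNat, u.toNat, fun n => ⟨fun hn => ?_, fun hn => ?_⟩, by omega⟩
  · have h1 := hu n hn
    have h2 := hu _ (hsymm n hn)
    omega
  · by_cases h : 0 ≤ 2 * n + c
    · have := half (u - n).toNat (by omega)
      convert this using 1; omega
    · have := hsymm _ (half (u - (-c - n)).toNat (by omega))
      convert this using 1; omega

/-! ### Weyl groups and orbits in the hyperbolic extension -/

section Weyl

variable {V : Type*} [AddCommGroup V] [Module ℝ V] {B : LinearMap.BilinForm ℝ V}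
  {D : Submodule ℝ V} {hD : IsCompl (radical B) D}

lemma hypForm_inl (x y : V) : hypForm B hD (x, 0) (y, 0) = B x y := by
  simp [hypForm]

lemma isSymm_hypForm (hB : B.IsSymm) : (hypForm B hD).IsSymm :=
  ⟨fun x y => by simp only [hypForm, LinearMap.mk₂_apply, hB.eq x.1 y.1]; ring⟩

lemma reflection_hypForm_inl (α x : V) :
    reflection (hypForm B hD) (α, 0) (x, 0) = (reflection B α x, 0) := by
  simp [reflection_apply, hypForm_inl]

lemma weyl_induction {P : Set V} {p : (Hyp B ≃ₗ[ℝ] Hyp B) → Prop} (one : p 1)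
    (mul : ∀ α ∈ P, ∀ w ∈ weyl B hD P, p w → p (reflection (hypForm B hD) (α, 0) * w))
    {w : Hyp B ≃ₗ[ℝ] Hyp B} (hw : w ∈ weyl B hD P) : p w := by
  refine Subgroup.closure_induction_left (p := fun w _ => p w) one ?_ ?_ hw
  · rintro _ ⟨α, hα, rfl⟩ w hw h
    exact mul α hα w hw h
  -- A reflection is definitionally its own inverse, so `mul` applies unchanged.
  · rintro _ ⟨α, hα, rfl⟩ w hw h
    exact mul α hα w hw h

lemma reflection_mem_weyl {P : Set V} {α : V} (hα : α ∈ P) :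
    reflection (hypForm B hD) (α, 0) ∈ weyl B hD P :=
  Subgroup.subset_closure ⟨α, hα, rfl⟩

lemma weyl_isometry (hB : B.IsSymm) {P : Set V} {w : Hyp B ≃ₗ[ℝ] Hyp B}
    (hw : w ∈ weyl B hD P) (x y : Hyp B) :
    hypForm B hD (w x) (w y) = hypForm B hD x y := by
  refine weyl_induction (p := fun w => hypForm B hD (w x) (w y) = hypForm B hD x y) rfl ?_ hw
  intro α _ w _ h
  rw [LinearEquiv.mul_apply, LinearEquiv.mul_apply,
    apply_reflection_reflection (isSymm_hypForm hB), h]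

lemma orbit_induction {P : Set V} {p : V → Prop} (base : ∀ α ∈ P, p α)
    (step : ∀ α ∈ P, ∀ β ∈ orbit B hD P, p β → p (reflection B α β)) {β : V}
    (hβ : β ∈ orbit B hD P) : p β := by
  obtain ⟨w, hw, α, hα, h⟩ := hβ
  revert β
  refine weyl_induction (p := fun w => ∀ {β : V}, w (α, 0) = (β, 0) → p β) ?_ ?_ hw
  · intro β h
    obtain rfl : α = β := congrArg Prod.fst h
    exact base _ hα
  · intro γ hγ w hw ih β h
    have h' : w (α, 0) = (reflection B γ β, 0) := by
      rw [← reflection_hypForm_inl (hD := hD), ← h, LinearEquiv.mul_apply, reflection_reflection]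
    rw [← reflection_reflection B γ β]
    exact step γ hγ _ ⟨w, hw, α, hα, h'⟩ (ih h')

lemma subset_orbit (P : Set V) : P ⊆ orbit B hD P :=
  fun α hα => ⟨1, one_mem _, α, hα, rfl⟩

/-- If `α = w γ` with `γ ∈ P`, then `w_α = w w_γ w⁻¹`, because `w` is an isometry. -/
lemma reflection_mem_weyl_of_mem_orbit (hB : B.IsSymm) {P : Set V} {α : V}
    (hα : α ∈ orbit B hD P) : reflection (hypForm B hD) (α, 0) ∈ weyl B hD P := by
  obtain ⟨w, hw, γ, hγ, h⟩ := hα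
  rw [← h, reflection_map w (weyl_isometry hB hw)]
  exact mul_mem (mul_mem hw (reflection_mem_weyl hγ)) (inv_mem hw)

lemma reflection_mem_orbit (hB : B.IsSymm) {P : Set V} {α β : V} (hα : α ∈ orbit B hD P)
    (hβ : β ∈ orbit B hD P) : reflection B α β ∈ orbit B hD P := by
  obtain ⟨w, hw, γ, hγ, h⟩ := hβ
  exact ⟨_, mul_mem (reflection_mem_weyl_of_mem_orbit hB hα) hw, γ, hγ, by
    rw [LinearEquiv.mul_apply, h, reflection_hypForm_inl]⟩

/-- If `w_α ∈ W_P` then `α` lies in the span of `P`. -/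
lemma mem_span_of_reflection_mem_weyl {P : Set V} {α : V} (hα : B α α ≠ 0)
    (h : reflection (hypForm B hD) (α, 0) ∈ weyl B hD P) : α ∈ Submodule.span ℝ P := by
  -- Applied to `w_α` and `α`, whose displacement is `-2α`.
  have key : ∀ w ∈ weyl B hD P, ∀ x : V, ∃ y ∈ Submodule.span ℝ P, w (x, 0) = (x + y, 0) := by
    intro w hw x
    refine weyl_induction
      (p := fun w => ∃ y ∈ Submodule.span ℝ P, w (x, 0) = (x + y, 0)) ⟨0, zero_mem _, by simp⟩ ?_ hw
    rintro α hα w - ⟨y, hy, h⟩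
    refine ⟨y - (2 * B (x + y) α / B α α) • α,
      sub_mem hy (Submodule.smul_mem _ _ (Submodule.subset_span hα)), ?_⟩
    rw [LinearEquiv.mul_apply, h, reflection_hypForm_inl, reflection_apply, add_sub_assoc]
  obtain ⟨y, hy, hxy⟩ := key _ h α
  rw [reflection_hypForm_inl, reflection_self hα] at hxy
  have h1 : -α = α + y := congrArg Prod.fst hxy
  have h2 : α = (-(1 / 2) : ℝ) • y := by
    rw [show y = -α - α by rw [h1]; abel]; module
  rw [h2]
  exact Submodule.smul_mem _ _ hy

/-! ### The subsystem `R_P` -/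

section Subsystem

variable {R P : Set V}

lemma subForm_apply (x y : subSpan B hD R P) : subForm B hD R P x y = B x y := rfl

lemma isPosSemidef_subForm (hB : B.IsPosSemidef) : (subForm B hD R P).IsPosSemidef where
  eq _ _ := hB.isSymm.eq _ _
  nonneg _ := hB.nonneg _

/-- Semidefiniteness is essential: for an indefinite form the radical of a restriction may be
larger. -/
lemma mem_radical_subForm (hB : B.IsPosSemidef) {x : subSpan B hD R P} :
    x ∈ radical (subForm B hD R P) ↔ (x : V) ∈ radical B := by
  rw [mem_radical_iff hB, mem_radical_iff (isPosSemidef_subForm hB), subForm_apply]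

lemma subsystem_subset_subSpan : subsystem B hD R P ⊆ subSpan B hD R P := Submodule.subset_span

variable [TopologicalSpace V]

lemma orbit_subset_nonIsoRoots (hR : IsEARS B R) (hP : P ⊆ nonIsoRoots B R) :
    orbit B hD P ⊆ nonIsoRoots B R := fun _ hβ =>
  orbit_induction (p := fun β => β ∈ nonIsoRoots B R) hP
    (fun _ hα _ _ h => hR.reflection_mem_nonIsoRoots (hP hα) h) hβ

lemma neg_mem_orbit (hR : IsEARS B R) (hP : P ⊆ nonIsoRoots B R) {α : V}
    (hα : α ∈ orbit B hD P) : -α ∈ orbit B hD P := by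
  rw [← reflection_self (B := B)
    ((mem_nonIsoRoots_iff hR.posSemidef).1 (orbit_subset_nonIsoRoots hR hP hα)).2]
  exact reflection_mem_orbit hR.posSemidef.isSymm hα hα

lemma subsystem_subset (hR : IsEARS B R) (hP : P ⊆ nonIsoRoots B R) :
    subsystem B hD R P ⊆ R :=
  Set.union_subset ((orbit_subset_nonIsoRoots hR hP).trans Set.sdiff_subset) fun _ h => h.2.1

lemma mem_orbit_of_mem_subsystem (hR : IsEARS B R) {β : V}
    (hβ : β ∈ subsystem B hD R P) (h : B β β ≠ 0) : β ∈ orbit B hD P :=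
  hβ.resolve_right fun h' => h ((mem_radical_iff hR.posSemidef).1 h'.2.2)

lemma mem_subIso_of_mem_subsystem (hR : IsEARS B R) (hP : P ⊆ nonIsoRoots B R) {β : V}
    (hβ : β ∈ subsystem B hD R P) (h : B β β = 0) : β ∈ subIso B hD R P :=
  hβ.resolve_left fun h' =>
    ((mem_nonIsoRoots_iff hR.posSemidef).1 (orbit_subset_nonIsoRoots hR hP h')).2 h

lemma neg_mem_subsystem (hR : IsEARS B R) (hP : P ⊆ nonIsoRoots B R) {β : V}
    (hβ : β ∈ subsystem B hD R P) : -β ∈ subsystem B hD R P := by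
  rcases hβ with hβ | ⟨⟨x, hx, y, hy, rfl⟩, h⟩
  · exact Or.inl (neg_mem_orbit hR hP hβ)
  · exact Or.inr ⟨⟨y, hy, x, hx, by simp⟩, hR.neg_mem h.1, neg_mem h.2⟩

lemma reflection_mem_subsystem (hR : IsEARS B R) {α β : V} (hα : α ∈ orbit B hD P)
    (hβ : β ∈ subsystem B hD R P) : reflection B α β ∈ subsystem B hD R P := by
  rcases hβ with hβ | hβ
  · exact Or.inl (reflection_mem_orbit hR.posSemidef.isSymm hα hβ)
  · rw [reflection_of_apply_eq_zero (by rw [LinearMap.mem_ker.1 hβ.2.2]; rfl)]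
    exact Or.inr hβ

lemma add_mem_subsystem (hR : IsEARS B R) (hP : P ⊆ nonIsoRoots B R) {α β : V}
    (hα : α ∈ orbit B hD P) (hβ : β ∈ subsystem B hD R P) (h : B α β < 0) :
    β + α ∈ subsystem B hD R P := by
  have hs := hR.posSemidef
  have hsub := orbit_subset_nonIsoRoots hR hP (hD := hD)
  replace hβ : β ∈ orbit B hD P := mem_orbit_of_mem_subsystem hR hβ fun h0 => h.ne <| by
    rw [hs.isSymm.eq α β, LinearMap.mem_ker.1 ((mem_radical_iff hs).2 h0)]; rfl
  rcases hR.reflection_eq_add_or (hsub hα) (hsub hβ) h with h | h | h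
  · rw [← h]; exact Or.inl (reflection_mem_orbit hs.isSymm hα hβ)
  · rw [← h]; exact Or.inl (reflection_mem_orbit hs.isSymm hβ hα)
  · exact Or.inr ⟨⟨β, hβ, -α, neg_mem_orbit hR hP hα, by simp⟩, h⟩

/-- Strings in `R_P` are bounded since those in `R` are, symmetric under `w_α`, and unbroken on the
side where the pairing with `α` is negative. -/
lemma subsystem_string (hR : IsEARS B R) (hP : P ⊆ nonIsoRoots B R) {α β : V}
    (hα : α ∈ orbit B hD P) (hβ : β ∈ subsystem B hD R P) :
    ∃ d u : ℕ, (∀ n : ℤ, β + n • α ∈ subsystem B hD R P ↔ -(d : ℤ) ≤ n ∧ n ≤ (u : ℤ)) ∧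
      (d : ℝ) - (u : ℝ) = 2 * B α β / B α α := by
  have hs := hR.posSemidef
  have hα' := orbit_subset_nonIsoRoots hR hP hα
  have hα0 := ((mem_nonIsoRoots_iff hs).1 hα').2
  obtain ⟨c, hc⟩ := hR.exists_int hα' (subsystem_subset hR hP hβ)
  have hc' : (c : ℝ) * B α α = 2 * B α β := by rw [hc]; field_simp
  have hval : ∀ n : ℤ, 2 * B α (β + n • α) = (2 * n + c : ℤ) * B α α := by
    intro n
    rw [← Int.cast_smul_eq_zsmul ℝ, map_add, map_smul, smul_eq_mul]
    push_cast
    linarith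
  have hbdd : BddAbove {n : ℤ | β + n • α ∈ subsystem B hD R P} := by
    obtain ⟨d, u, h, -⟩ := hR.string α hα' β (subsystem_subset hR hP hβ)
    exact ⟨u, fun n hn => ((h n).1 (subsystem_subset hR hP hn)).2⟩
  have hsymm : ∀ n : ℤ, β + n • α ∈ subsystem B hD R P →
      β + (-c - n) • α ∈ subsystem B hD R P := by
    intro n hn
    have := reflection_mem_subsystem hR hα hn
    rw [reflection_apply, hs.isSymm.eq _ α, hval, mul_div_assoc, div_self hα0, mul_one,
      Int.cast_smul_eq_zsmul, add_sub_assoc, ← sub_smul] at this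
    convert this using 3
    ring
  have hstep : ∀ n : ℤ, β + n • α ∈ subsystem B hD R P → 2 * n + c < 0 →
      β + (n + 1) • α ∈ subsystem B hD R P := by
    intro n hn hneg
    have h1 : ((2 * n + c : ℤ) : ℝ) < 0 := by exact_mod_cast hneg
    have := add_mem_subsystem hR hP hα hn
      (by nlinarith [hval n, mul_neg_of_neg_of_pos h1 (apply_self_pos hs hα0)])
    rw [add_smul, one_smul, ← add_assoc]
    exact this
  obtain ⟨d, u, h, hdu⟩ := exists_string (by simpa using hβ) hbdd hsymm hstep
  exact ⟨d, u, h, by rw [← hc, ← hdu]; push_cast; ring⟩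

/-- A splitting of the orbit splits `P`, provided both parts meet `P`. If `P ⊆ O₁`, no reflection in
`P` can leave `O₁`, as an image in `O₂` would be orthogonal to the reflecting root and hence fixed.
-/
lemma connected_orbit (hR : IsEARS B R) (hconn : Connected B P) :
    Connected B (orbit B hD P) := by
  have hs := hR.posSemidef
  have key : ∀ O₁ O₂ : Set V, O₁ ∪ O₂ = orbit B hD P → Disjoint O₁ O₂ → O₂.Nonempty →
      (∀ a ∈ O₁, ∀ b ∈ O₂, B a b = 0) → (P ∩ O₂).Nonempty := by
    intro O₁ O₂ hU hdisj ⟨b, hb⟩ horth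
    by_contra hemp
    have hP1 : P ⊆ O₁ := fun a ha => by
      rcases hU ▸ subset_orbit P ha with h | h
      · exact h
      · exact absurd ⟨a, ha, h⟩ hemp
    have : ∀ x ∈ orbit B hD P, x ∈ O₁ := by
      intro x hx
      refine orbit_induction (p := fun x => x ∈ O₁) hP1 (fun α hα β hβ h => ?_) hx
      have h1 := reflection_mem_orbit hs.isSymm (subset_orbit P hα) hβ
      rcases hU ▸ h1 with h2 | h2
      · exact h2
      · have h3 : B (reflection B α β) α = 0 := by
          rw [hs.isSymm.eq]; exact horth _ (hP1 hα) _ h2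
        rw [← reflection_reflection B α β, reflection_of_apply_eq_zero h3] at h
        exact h
    exact Set.disjoint_left.1 hdisj (this b (hU ▸ Or.inr hb)) hb
  rintro ⟨O₁, O₂, hU, hdisj, hne1, hne2, horth⟩
  refine hconn ⟨P ∩ O₁, P ∩ O₂, ?_, hdisj.mono Set.inter_subset_right Set.inter_subset_right,
    ?_, key O₁ O₂ hU hdisj hne2 horth, fun a ha b hb => horth a ha.2 b hb.2⟩
  · rw [← Set.inter_union_distrib_left, hU, Set.inter_eq_left.2 (subset_orbit P)]
  · exact key O₂ O₁ (by rw [Set.union_comm, hU]) hdisj.symm hne1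
      fun a ha b hb => by rw [hs.isSymm.eq]; exact horth b hb a ha

lemma weyl_subsystem (hR : IsEARS B R) :
    weyl B hD P = weyl B hD (subsystem B hD R P) := by
  have hs := hR.posSemidef
  refine le_antisymm (Subgroup.closure_mono ?_) ((Subgroup.closure_le _).2 ?_)
  · rintro _ ⟨α, hα, rfl⟩
    exact ⟨α, Or.inl (subset_orbit P hα), rfl⟩
  · rintro _ ⟨α, hα | hα, rfl⟩
    · exact reflection_mem_weyl_of_mem_orbit hs.isSymm hα
    · rw [reflection_of_isotropic (by
        rw [hypForm_inl]; exact (mem_radical_iff hs).1 hα.2.2)]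
      exact one_mem _

lemma mem_nonIsoRoots_subIn (hR : IsEARS B R) (hP : P ⊆ nonIsoRoots B R)
    {x : subSpan B hD R P} :
    x ∈ nonIsoRoots (subForm B hD R P) (subIn B hD R P) ↔ (x : V) ∈ orbit B hD P := by
  rw [mem_nonIsoRoots_iff (isPosSemidef_subForm hR.posSemidef), subForm_apply]
  exact ⟨fun h => mem_orbit_of_mem_subsystem hR h.1 h.2, fun h => ⟨Or.inl h,
    ((mem_nonIsoRoots_iff hR.posSemidef).1 (orbit_subset_nonIsoRoots hR hP h)).2⟩⟩

lemma mem_isoRoots_subIn (hR : IsEARS B R) (hP : P ⊆ nonIsoRoots B R)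
    {x : subSpan B hD R P} :
    x ∈ isoRoots (subForm B hD R P) (subIn B hD R P) ↔ (x : V) ∈ subIso B hD R P := by
  have hs := hR.posSemidef
  constructor
  · rintro ⟨h1, h2⟩
    exact mem_subIso_of_mem_subsystem hR hP h1
      ((mem_radical_iff hs).1 ((mem_radical_subForm hs).1 h2))
  · exact fun h => ⟨Or.inr h, (mem_radical_subForm hs).2 h.2.2⟩

lemma image_nonIsoRoots_subIn (hR : IsEARS B R) (hP : P ⊆ nonIsoRoots B R) :
    Subtype.val '' nonIsoRoots (subForm B hD R P) (subIn B hD R P) = orbit B hD P := by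
  ext x
  constructor
  · rintro ⟨y, hy, rfl⟩
    exact (mem_nonIsoRoots_subIn hR hP).1 hy
  · exact fun h => ⟨⟨x, subsystem_subset_subSpan (Or.inl h)⟩, (mem_nonIsoRoots_subIn hR hP).2 h, rfl⟩

lemma image_isoRoots_subIn (hR : IsEARS B R) (hP : P ⊆ nonIsoRoots B R) :
    Subtype.val '' isoRoots (subForm B hD R P) (subIn B hD R P) = subIso B hD R P := by
  ext x
  constructor
  · rintro ⟨y, hy, rfl⟩
    exact (mem_isoRoots_subIn hR hP).1 hy
  · exact fun h => ⟨⟨x, subsystem_subset_subSpan (Or.inr h)⟩, (mem_isoRoots_subIn hR hP).2 h, rfl⟩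

lemma isEARS_subIn (hR : IsEARS B R) (hP : P ⊆ nonIsoRoots B R) (hne : P.Nonempty)
    (hconn : Connected B P) : IsEARS (subForm B hD R P) (subIn B hD R P) where
  posSemidef := isPosSemidef_subForm hR.posSemidef
  zero_mem := by
    obtain ⟨α, hα⟩ := hne
    exact Or.inr ⟨⟨α, subset_orbit P hα, α, subset_orbit P hα, by simp⟩, hR.zero_mem, zero_mem _⟩
  neg_eq := by
    ext x
    refine ⟨fun h => neg_mem_subsystem hR hP h, fun h => ?_⟩
    simpa [subIn] using neg_mem_subsystem hR hP (show ((-x : subSpan B hD R P) : V) ∈ _ from h)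
  span_eq := Submodule.span_span_coe_preimage
  two_nsmul_notMem α hα h :=
    hR.two_nsmul_notMem _ (orbit_subset_nonIsoRoots hR hP ((mem_nonIsoRoots_subIn hR hP).1 hα))
      (subsystem_subset hR hP h)
  discrete := (hR.discrete.mono (subsystem_subset hR hP)).preimage
    continuous_subtype_val.continuousOn Subtype.val_injective
  string α hα β hβ := subsystem_string hR hP ((mem_nonIsoRoots_subIn hR hP).1 hα) hβ
  connected := by
    rintro ⟨O₁, O₂, hU, hdisj, hne1, hne2, horth⟩
    refine connected_orbit hR hconn (hD := hD) ⟨Subtype.val '' O₁, Subtype.val '' O₂, ?_,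
      (Set.disjoint_image_iff Subtype.val_injective).2 hdisj, hne1.image _, hne2.image _, ?_⟩
    · rw [← Set.image_union, hU, image_nonIsoRoots_subIn hR hP]
    · rintro _ ⟨a, ha, rfl⟩ _ ⟨b, hb, rfl⟩
      exact horth a ha b hb
  exists_add_mem σ hσ := by
    obtain ⟨⟨x, hx, y, hy, hxy⟩, -⟩ := (mem_isoRoots_subIn hR hP).1 hσ
    refine ⟨⟨y, subsystem_subset_subSpan (Or.inl hy)⟩, (mem_nonIsoRoots_subIn hR hP).2 hy,
      Or.inl ?_⟩
    have : y + (σ : V) = x := by rw [← hxy]; simp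
    simpa [this] using hx

lemma isReducedType_subIn (hR : IsEARS B R) (hred : IsReducedType B R)
    (hP : P ⊆ nonIsoRoots B R) : IsReducedType (subForm B hD R P) (subIn B hD R P) := by
  have hs := hR.posSemidef
  rintro _ ⟨x, hx, rfl⟩ hx0 ⟨y, hy, hyx⟩
  refine hred _ ⟨x, subsystem_subset hR hP hx, rfl⟩ (fun h => hx0 ?_)
    ⟨y, subsystem_subset hR hP hy, ?_⟩
  · simp only [Submodule.mkQ_apply, Submodule.Quotient.mk_eq_zero] at h ⊢
    exact (mem_radical_subForm hs).2 h
  · rw [← map_smul, Submodule.mkQ_apply, Submodule.mkQ_apply, Submodule.Quotient.eq] at hyx ⊢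
    exact (mem_radical_subForm hs).1 hyx

/-- Each isotropic root `σ` equals `(α + σ) - α` for some non-isotropic `α`, so the differences
recover all of `R⁰`. -/
lemma subsystem_eq_of_orbit_eq (hR : IsEARS B R) (h : orbit B hD P = nonIsoRoots B R) :
    subsystem B hD R P = R := by
  have : subIso B hD R P = isoRoots B R := by
    refine Set.inter_eq_right.2 fun σ hσ => ?_
    obtain ⟨α, hα, hσα⟩ := hR.exists_add_mem σ hσ
    rw [h]
    exact ⟨α + σ, ⟨hσα, fun h' => hα.2 ⟨hα.1, by simpa using sub_mem h'.2 hσ.2⟩⟩, α, hα, by simp⟩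
  rw [subsystem, this, h]
  exact Set.sdiff_union_of_subset Set.inter_subset_left

lemma subSpan_eq_top (hR : IsEARS B R) (h : weylGroup B hD R = weyl B hD P) :
    subSpan B hD R P = ⊤ := by
  rw [eq_top_iff, ← hR.span_nonIsoRoots, Submodule.span_le]
  intro α hα
  refine Submodule.span_mono (fun x hx => Or.inl (subset_orbit P hx))
    (mem_span_of_reflection_mem_weyl (hD := hD) ((mem_nonIsoRoots_iff hR.posSemidef).1 hα).2 ?_)
  rw [← h]
  exact reflection_mem_weyl hα

end Subsystem

end Weyl

/-! ### The sign of the product of positive roots, and the type -/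

/-- Let `Φ` be a positive system (with respect to `x`) of functionals that the involution `s`
permutes up to signs, and let `b` be the only member of `Φ` that `s` negates. Then `s` negates the
product of the members of `Φ`. -/
lemma prod_apply_reflection {V : Type*} [AddCommGroup V] [Module ℝ V]
    {Φ : Finset (Module.Dual ℝ V)} {x : V} {s : V →ₗ[ℝ] V} {b : Module.Dual ℝ V}
    (hs : s ∘ₗ s = LinearMap.id) (hpos : ∀ f ∈ Φ, 0 < f x)
    (hΦ : ∀ f ∈ Φ, f ∘ₗ s ∈ Φ ∨ -(f ∘ₗ s) ∈ Φ) (hb : b ∈ Φ) (hbs : b ∘ₗ s = -b)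
    (huniq : ∀ f ∈ Φ, f ∘ₗ s = -f → f = b) {y : V} (hy : ∀ f ∈ Φ, f y ≠ 0) :
    ∏ f ∈ Φ, f (s y) = -∏ f ∈ Φ, f y := by
  classical
  have hss : ∀ f : Module.Dual ℝ V, (f ∘ₗ s) ∘ₗ s = f := fun f => by
    rw [LinearMap.comp_assoc, hs, LinearMap.comp_id]
  have hssy : ∀ z, s (s z) = z := fun z => LinearMap.congr_fun hs z
  let τ : Module.Dual ℝ V → Module.Dual ℝ V := fun f => if 0 < f (s x) then f ∘ₗ s else -(f ∘ₗ s)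
  have hτ : ∀ f, τ f = f ∘ₗ s ∨ τ f = -(f ∘ₗ s) := fun f => by
    by_cases h : 0 < f (s x) <;> simp [τ, h]
  have hτmem : ∀ f ∈ Φ, τ f ∈ Φ := fun f hf => by
    rcases hΦ f hf with h | h
    · have : 0 < f (s x) := hpos _ h
      simpa [τ, this] using h
    · have : 0 < -f (s x) := hpos _ h
      have : ¬ 0 < f (s x) := by linarith
      simpa only [τ, this, if_false] using h
  have hττ : ∀ f ∈ Φ, τ (τ f) = f := fun f hf => by
    have hx := hpos f hf
    by_cases h : 0 < f (s x)
    · have h1 : τ f = f ∘ₗ s := by simp [τ, h]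
      have h2 : 0 < (f ∘ₗ s) (s x) := by simpa [hssy] using hx
      rw [h1]
      simp only [τ, h2, if_true, hss]
    · have h1 : τ f = -(f ∘ₗ s) := by simp [τ, h]
      have h2 : ¬ 0 < (-(f ∘ₗ s)) (s x) := by simpa [hssy] using hx.le
      rw [h1]
      simp only [τ, h2, if_false, LinearMap.neg_comp, hss, neg_neg]
  have hne : ∀ f ∈ Φ, f ≠ b → τ f ≠ b := fun f hf hfb h => by
    have h2 : τ b = b := by
      rcases hτ b with h' | h'
      · have h0 := hpos _ (hτmem b hb)
        rw [h', hbs, LinearMap.neg_apply] at h0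
        linarith [hpos b hb]
      · rw [h', hbs, neg_neg]
    exact hfb (by rw [← hττ f hf, h, h2])
  -- The factors at `f` and `τ f` are mutually inverse, the sign in `τ` cancelling in the quotient.
  -- A fixed point of `τ` other than `b` satisfies `f ∘ s = f` and contributes 1.
  have key : ∏ f ∈ Φ.erase b, f (s y) / f y = 1 := by
    refine Finset.prod_involution (fun f _ => τ f) (fun f hf => ?_) (fun f hf h1 h2 => ?_)
      (fun f hf => ?_) (fun f hf => ?_)
    · have hf' := Finset.mem_of_mem_erase hf
      have h0 := hy f hf'
      have h3 := hy _ (hτmem f hf')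
      rcases hτ f with h | h <;> rw [h] at h3 ⊢ <;>
        simp only [LinearMap.neg_apply, LinearMap.comp_apply, hssy, ne_eq, neg_eq_zero] at h3 ⊢ <;>
        field_simp
    · have hf' := Finset.mem_of_mem_erase hf
      rcases hτ f with h | h
      · refine h1 ?_
        rw [show f (s y) = f y from LinearMap.congr_fun (h.symm.trans h2) y, div_self (hy f hf')]
      · exact Finset.ne_of_mem_erase hf
          (huniq f hf' (by rw [← neg_eq_iff_eq_neg, ← h, h2]))
    · exact Finset.mem_erase.2 ⟨hne f (Finset.mem_of_mem_erase hf) (Finset.ne_of_mem_erase hf),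
        hτmem f (Finset.mem_of_mem_erase hf)⟩
    · exact hττ f (Finset.mem_of_mem_erase hf)
  rw [Finset.prod_div_distrib, div_eq_one_iff_eq
    (Finset.prod_ne_zero_iff.2 fun f hf => hy f (Finset.mem_of_mem_erase hf))] at key
  rw [← Finset.mul_prod_erase Φ _ hb, ← Finset.mul_prod_erase Φ _ hb, key,
    show b (s y) = -b y from LinearMap.congr_fun hbs y, neg_mul]

section Weyl

variable {V : Type*} [AddCommGroup V] [Module ℝ V] [FiniteDimensional ℝ V] [TopologicalSpace V]
  {B : LinearMap.BilinForm ℝ V} {D : Submodule ℝ V} {hD : IsCompl (radical B) D} {R P : Set V}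

/-- If no root of `R_P` vanishes at `x`, then the product of the roots of `R̄_P` that are positive
at `x` changes under `w ∈ W_P` by the sign `det w`. -/
lemma exists_prod_ne_zero_and_det (hR : IsEARS B R) (hred : IsReducedType B R)
    (hP : P ⊆ nonIsoRoots B R) {x : V} (hx : ∀ β ∈ orbit B hD P, B β x ≠ 0) :
    ∃ Q : V → ℝ, Q x ≠ 0 ∧ ∀ w ∈ weyl B hD P, ∃ y, w (x, 0) = (y, 0) ∧
      Q y = LinearMap.det (w : Hyp B →ₗ[ℝ] Hyp B) * Q x := by
  classical
  have hs := hR.posSemidef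
  have hsub := orbit_subset_nonIsoRoots hR hP (hD := hD)
  have hfin : {f | f ∈ B '' orbit B hD P ∧ 0 < f x}.Finite :=
    (hR.finite_image.subset (Set.image_mono hsub)).subset fun f hf => hf.1
  set Φ := hfin.toFinset with hΦ
  have hmem : ∀ f, f ∈ Φ ↔ f ∈ B '' orbit B hD P ∧ 0 < f x := fun f => by simp [hΦ]
  have habs : ∀ β ∈ orbit B hD P, B β ∈ Φ ∨ -B β ∈ Φ := by
    intro β hβ
    rcases (hx β hβ).lt_or_gt with h | h
    · exact Or.inr ((hmem _).2 ⟨⟨-β, neg_mem_orbit hR hP hβ, by simp⟩, by simpa using h⟩)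
    · exact Or.inl ((hmem _).2 ⟨⟨β, hβ, rfl⟩, h⟩)
  have hstep : ∀ α ∈ orbit B hD P, ∀ y : V, (∀ β ∈ orbit B hD P, B β y ≠ 0) →
      ∏ f ∈ Φ, f (reflection B α y) = -∏ f ∈ Φ, f y := by
    intro α hα y hy
    wlog hαΦ : B α ∈ Φ generalizing α
    · have hn : reflection B (-α) = reflection B α := by
        ext z
        simp only [reflection_apply, map_neg, LinearMap.neg_apply, neg_neg]
        module
      rw [← hn]
      exact this _ (neg_mem_orbit hR hP hα)
        (by rw [map_neg]; exact (habs α hα).resolve_left hαΦ)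
    have hα0 := ((mem_nonIsoRoots_iff hs).1 (hsub hα)).2
    refine prod_apply_reflection (s := (reflection B α : V →ₗ[ℝ] V)) (b := B α) (x := x)
      (LinearMap.ext fun z => reflection_reflection B α z) (fun f hf => ((hmem f).1 hf).2) ?_ hαΦ ?_
      ?_ ?_
    · intro f hf
      obtain ⟨⟨β, hβ, rfl⟩, -⟩ := (hmem f).1 hf
      rw [apply_comp_reflection hs.isSymm]
      exact habs _ (reflection_mem_orbit hs.isSymm hα hβ)
    · rw [apply_comp_reflection hs.isSymm, reflection_self hα0, map_neg]
    · intro f hf h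
      obtain ⟨⟨β, hβ, rfl⟩, hpos⟩ := (hmem f).1 hf
      rw [apply_comp_reflection hs.isSymm, reflection_apply, map_sub, map_smul] at h
      have h2 : B β = (B β α / B α α) • B α := by
        have h3 : (2 : ℝ) • B β = (2 * B β α / B α α) • B α := by
          rw [two_smul]; nth_rewrite 1 [← sub_add_cancel (B β) ((2 * B β α / B α α) • B α)]
          rw [h]; abel
        rw [mul_div_assoc, mul_smul] at h3
        exact smul_right_injective _ (two_ne_zero' ℝ) h3
      -- Reducedness enters here: without it, positive multiples of `B α` in `Φ` would also change
      -- sign.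
      refine (hR.eq_or_eq_neg_of_apply_eq_smul hred (hsub hα) (hsub hβ) h2).resolve_right fun h => ?_
      rw [h, LinearMap.neg_apply] at hpos
      linarith [((hmem _).1 hαΦ).2]
    · intro f hf
      obtain ⟨⟨β, hβ, rfl⟩, -⟩ := (hmem f).1 hf
      exact hy β hβ
  refine ⟨fun y => ∏ f ∈ Φ, f y, Finset.prod_ne_zero_iff.2 fun f hf => ((hmem f).1 hf).2.ne',
    fun w hw => ?_⟩
  suffices ∃ y, (∀ β ∈ orbit B hD P, B β y ≠ 0) ∧ w (x, 0) = (y, 0) ∧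
      ∏ f ∈ Φ, f y = LinearMap.det (w : Hyp B →ₗ[ℝ] Hyp B) * ∏ f ∈ Φ, f x by
    obtain ⟨y, -, h⟩ := this
    exact ⟨y, h⟩
  refine weyl_induction (p := fun w => ∃ y, (∀ β ∈ orbit B hD P, B β y ≠ 0) ∧ w (x, 0) = (y, 0) ∧
    ∏ f ∈ Φ, f y = LinearMap.det (w : Hyp B →ₗ[ℝ] Hyp B) * ∏ f ∈ Φ, f x) ⟨x, hx, rfl, ?_⟩ ?_ hw
  · rw [show ((1 : Hyp B ≃ₗ[ℝ] Hyp B) : Hyp B →ₗ[ℝ] Hyp B) = LinearMap.id from rfl,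
      LinearMap.det_id, one_mul]
  · rintro α hα w - ⟨y, hy, hwy, hQ⟩
    have hα' := subset_orbit (hD := hD) P hα
    refine ⟨reflection B α y, fun β hβ => ?_, ?_, ?_⟩
    · rw [apply_reflection hs.isSymm]
      exact hy _ (reflection_mem_orbit hs.isSymm hα' hβ)
    · rw [LinearEquiv.mul_apply, hwy, reflection_hypForm_inl]
    · have : ((reflection (hypForm B hD) (α, 0) * w : Hyp B ≃ₗ[ℝ] Hyp B) : Hyp B →ₗ[ℝ] Hyp B) =
        (reflection (hypForm B hD) (α, 0) : Hyp B →ₗ[ℝ] Hyp B) ∘ₗ (w : Hyp B →ₗ[ℝ] Hyp B) := rfl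
      rw [hstep α hα' y hy, hQ, this, LinearMap.det_comp, det_reflection, neg_one_mul, neg_mul]
      rw [hypForm_inl]
      exact ((mem_nonIsoRoots_iff hs).1 (hP hα)).2

/-- Every root `α` of `R` with `w_α ∈ W_P` is, modulo the radical, a root of `R_P`. -/
lemma exists_mem_orbit_apply_eq (hR : IsEARS B R) (hred : IsReducedType B R)
    (hP : P ⊆ nonIsoRoots B R) {α : V} (hα : α ∈ nonIsoRoots B R)
    (h : reflection (hypForm B hD) (α, 0) ∈ weyl B hD P) :
    ∃ β ∈ orbit B hD P, B β = B α := by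
  by_contra! hno
  have hs := hR.posSemidef
  have hα0 := ((mem_nonIsoRoots_iff hs).1 hα).2
  have hsub := orbit_subset_nonIsoRoots hR hP (hD := hD)
  have hfin : (B '' orbit B hD P).Finite := hR.finite_image.subset (Set.image_mono hsub)
  have := hfin.to_subtype
  -- A generic point of the hyperplane `α^⊥`: none of the finitely many functionals of `R̄_P`
  -- vanishes on all of it, since it would then be a multiple of `B α`, hence `± B α` by
  -- reducedness.
  obtain ⟨x, hxα, hx⟩ := Module.Dual.exists_forall_mem_ne_zero_of_forall_exists
    (LinearMap.ker (B α)) (fun f : B '' orbit B hD P => (f : Module.Dual ℝ V)) (by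
      rintro ⟨_, β, hβ, rfl⟩
      by_contra! hker
      have h2 : B β = (B β α / B α α) • B α := by
        ext y
        have := hker (y - (B α y / B α α) • α) (by simp [hα0])
        simp only [map_sub, map_smul, smul_eq_mul, sub_eq_zero] at this
        rw [LinearMap.smul_apply, smul_eq_mul, this]
        ring
      rcases hR.eq_or_eq_neg_of_apply_eq_smul hred hα (hsub hβ) h2 with h3 | h3
      · exact hno β hβ h3
      · exact hno _ (neg_mem_orbit hR hP hβ) (by rw [map_neg, h3, neg_neg]))
  obtain ⟨Q, hQ, hQw⟩ := exists_prod_ne_zero_and_det hR hred hP (x := x) (hD := hD)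
    fun β hβ => hx ⟨_, β, hβ, rfl⟩
  obtain ⟨y, hy, hdet⟩ := hQw _ h
  rw [reflection_hypForm_inl, reflection_of_apply_eq_zero
    (by rw [hs.isSymm.eq]; exact LinearMap.mem_ker.1 hxα)] at hy
  obtain rfl : x = y := congrArg Prod.fst hy
  rw [det_reflection (by rwa [hypForm_inl])] at hdet
  exact hQ (by linarith)

/-- Here `V_P = V`, so the two radicals and quotients are identified, and only surjectivity onto
`R̄` needs the determinant argument. -/
lemma rank_nullity_sameType (hR : IsEARS B R) (hred : IsReducedType B R)
    (hP : P ⊆ nonIsoRoots B R) (hne : P.Nonempty) (h : weylGroup B hD R = weyl B hD P) :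
    rank (subForm B hD R P) = rank B ∧ nullity (subForm B hD R P) = nullity B ∧
      SameType (subForm B hD R P) (subIn B hD R P) B R := by
  have hs := hR.posSemidef
  have htop := subSpan_eq_top hR h
  let e : subSpan B hD R P ≃ₗ[ℝ] V := LinearEquiv.ofTop _ htop
  have he : (radical (subForm B hD R P)).map (e : subSpan B hD R P →ₗ[ℝ] V) = radical B := by
    ext x
    constructor
    · rintro ⟨y, hy, rfl⟩
      exact (mem_radical_subForm hs).1 hy
    · exact fun hx => ⟨⟨x, htop ▸ Submodule.mem_top⟩, (mem_radical_subForm hs).2 hx, rfl⟩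
  let φ := Submodule.Quotient.equiv _ _ e he
  refine ⟨φ.finrank_eq, ?_, φ, ?_⟩
  · rw [nullity, nullity, ← he]
    exact (LinearEquiv.finrank_map_eq e _).symm
  · ext a
    constructor
    · rintro ⟨_, ⟨x, hx, rfl⟩, rfl⟩
      exact ⟨x, subsystem_subset hR hP hx, rfl⟩
    · rintro ⟨x, hx, rfl⟩
      obtain ⟨y, hy, hxy⟩ : ∃ y ∈ subsystem B hD R P, B y = B x := by
        by_cases hx0 : x ∈ radical B
        · obtain ⟨α, hα⟩ := hne
          refine ⟨0, ?_, by rw [LinearMap.mem_ker.1 hx0, map_zero]⟩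
          exact Or.inr ⟨⟨α, subset_orbit P hα, α, subset_orbit P hα, by simp⟩, hR.zero_mem,
            zero_mem _⟩
        · have hxn : x ∈ nonIsoRoots B R := ⟨hx, fun h => hx0 h.2⟩
          obtain ⟨y, hy, hyx⟩ := exists_mem_orbit_apply_eq (hD := hD) hR hred hP hxn
            (h ▸ reflection_mem_weyl hxn)
          exact ⟨y, Or.inl hy, hyx⟩
      refine ⟨_, ⟨⟨y, subsystem_subset_subSpan hy⟩, hy, rfl⟩, ?_⟩
      refine (Submodule.Quotient.eq (radical B)).2 (LinearMap.mem_ker.2 ?_)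
      rw [map_sub, sub_eq_zero]
      exact hxy

end Weyl

end EARS

theorem proposition2 {V : Type*} [AddCommGroup V] [Module ℝ V] [FiniteDimensional ℝ V]
    [TopologicalSpace V] [IsTopologicalAddGroup V] [ContinuousSMul ℝ V] [T2Space V]
    (B : LinearMap.BilinForm ℝ V) (R : Set V)
    (hR : EARS.IsEARS B R) (hred : EARS.IsReducedType B R)
    (D : Submodule ℝ V) (hD : IsCompl (EARS.radical B) D)
    (P : Set V) (hPR : P ⊆ EARS.nonIsoRoots B R) (hne : P.Nonempty) (hconn : EARS.Connected B P) :
    -- (i)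
    (EARS.IsEARS (EARS.subForm B hD R P) (EARS.subIn B hD R P) ∧
      EARS.IsReducedType (EARS.subForm B hD R P) (EARS.subIn B hD R P) ∧
      Subtype.val '' EARS.nonIsoRoots (EARS.subForm B hD R P) (EARS.subIn B hD R P)
        = EARS.orbit B hD P ∧
      Subtype.val '' EARS.isoRoots (EARS.subForm B hD R P) (EARS.subIn B hD R P)
        = EARS.subIso B hD R P ∧
      EARS.weyl B hD P = EARS.weyl B hD (EARS.subsystem B hD R P)) ∧
    -- (ii)
    (EARS.weylGroup B hD R = EARS.weyl B hD P →
      EARS.rank (EARS.subForm B hD R P) = EARS.rank B ∧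
      EARS.nullity (EARS.subForm B hD R P) = EARS.nullity B ∧
      EARS.SameType (EARS.subForm B hD R P) (EARS.subIn B hD R P) B R) ∧
    (EARS.IsCMinimal B hD R P ∨ EARS.IsSMinimal B hD R P →
      EARS.rank (EARS.subForm B hD R P) = EARS.rank B ∧
      EARS.nullity (EARS.subForm B hD R P) = EARS.nullity B ∧
      EARS.SameType (EARS.subForm B hD R P) (EARS.subIn B hD R P) B R) ∧
    -- (iii)
    (EARS.IsReflectable B hD R P → EARS.subsystem B hD R P = R) := by
  refine ⟨⟨EARS.isEARS_subIn hR hPR hne hconn, EARS.isReducedType_subIn hR hred hPR,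
    EARS.image_nonIsoRoots_subIn hR hPR, EARS.image_isoRoots_subIn hR hPR,
    EARS.weyl_subsystem hR⟩, fun h => EARS.rank_nullity_sameType hR hred hPR hne h, fun h => ?_,
    fun h => EARS.subsystem_eq_of_orbit_eq hR h.2⟩
  rcases h with h | h
  · exact EARS.rank_nullity_sameType hR hred hPR hne h.2.2.symm
  · exact EARS.rank_nullity_sameType hR hred hPR hne h.2.1.symm
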